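/- All graphs are finite and simple. A \emph{total graph} is a triple $H=(V_0,V_1,E)$ where $V_0$ and $V_1$ are disjoint sets (of \emph{empty} and \emph{full} vertices) and $E$ is a set of $2$-element subsets of $V_0\cup V_1$. The \emph{total degree} of a vertex $v$ in $H$ is the number of edges in $E$ containing $v$, plus $1$ if $v\in V_1$. The total graph $H$ is \emph{locally irregular} if the ends of every edge in $E$ have distinct total degrees. A \emph{total coloring} of a graph $G$ assigns a color to every vertex and every edge of $G$ (with no properness required). A color $i$ induces the total graph whose edges are the edges of $G$ of color $i$, whose full vertices are the vertices of $G$ of color $i$, and whose empty vertices are the ends of edges of color $i$ that do not themselves have color $i$. A total coloring is \emph{locally irregular} if every color induces a locally irregular total graph, and $\operatorname{tlir}(G)$ denotes the minimum number of colors in a locally irregular total coloring of $G$. A \emph{cactus} is a connected graph in which any two distinct cycles have no common edge. \textbf{Theorem.} Every cactus $G$ satisfies $\operatorname{tlir}(G)\le 2$. That is, the vertices and edges of $G$ can be colored with two colors so that each color induces a locally irregular total graph. -/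

import Mathlib

/-- A total graph on vertices taken from the type `V`: disjoint sets of empty and full vertices,
and a set of edges, each of which is a two-element subset of the set of all vertices. -/
structure TotalGraph (V : Type*) where
  /-- the set of empty vertices -/
  emptyVerts : Set V
  /-- the set of full vertices -/
  fullVerts : Set V
  /-- the set of edges -/
  edges : Set (Sym2 V)
  disjoint_verts : Disjoint emptyVerts fullVerts
  not_isDiag : ∀ e ∈ edges, ¬ e.IsDiag
  mem_verts : ∀ e ∈ edges, ∀ v ∈ e, v ∈ emptyVerts ∪ fullVerts

namespace TotalGraph

open Classical in
/-- The total degree of `v`: the number of edges containing `v`, plus `1` if `v` is full.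
(The number of edges is meaningful whenever `v` lies on finitely many edges, in particular
for a finite `V`.) -/
noncomputable def totalDegree {V : Type*} (H : TotalGraph V) (v : V) : ℕ :=
  {e ∈ H.edges | v ∈ e}.ncard + if v ∈ H.fullVerts then 1 else 0

/-- A total graph is locally irregular if the two ends of every edge have distinct total
degrees. -/
def IsLocallyIrregular {V : Type*} (H : TotalGraph V) : Prop :=
  ∀ u v : V, s(u, v) ∈ H.edges → H.totalDegree u ≠ H.totalDegree v

end TotalGraph

namespace SimpleGraph

/-- A (not necessarily proper) total coloring of `G` with colors in `K`: every vertex and every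
edge of `G` receives a color. -/
structure TotalColoring {V : Type*} (G : SimpleGraph V) (K : Type*) where
  /-- the colors of the vertices -/
  vertexColor : V → K
  /-- the colors of the edges -/
  edgeColor : G.edgeSet → K

namespace TotalColoring

/-- The total subgraph of `G` induced by the color `i`: its edges are the edges of color `i`, its
full vertices are the vertices of color `i`, and its empty vertices are the remaining ends of the
edges of color `i`. -/
def colorClass {V K : Type*} {G : SimpleGraph V} (c : G.TotalColoring K) (i : K) :
    TotalGraph V where
  emptyVerts := {v | c.vertexColor v ≠ i ∧ ∃ e : G.edgeSet, c.edgeColor e = i ∧ v ∈ e.1}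
  fullVerts := {v | c.vertexColor v = i}
  edges := {e | ∃ h : e ∈ G.edgeSet, c.edgeColor ⟨e, h⟩ = i}
  disjoint_verts := Set.disjoint_left.mpr fun _ h h' => h.1 h'
  not_isDiag := fun _ h => G.not_isDiag_of_mem_edgeSet h.1
  mem_verts := fun e h v hv => by
    by_cases hc : c.vertexColor v = i
    · exact Or.inr hc
    · exact Or.inl ⟨hc, ⟨e, h.1⟩, h.2, hv⟩

/-- A total coloring is a locally irregular total coloring (TLIR coloring) if every color induces
a locally irregular total subgraph. -/
def IsTLIR {V K : Type*} {G : SimpleGraph V} (c : G.TotalColoring K) : Prop :=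
  ∀ i : K, (c.colorClass i).IsLocallyIrregular

end TotalColoring

/-- The locally irregular total chromatic index: the minimum number of colors in a locally
irregular total coloring of `G` (and `⊤` if there is no such coloring with finitely many
colors). -/
noncomputable def tlir {V : Type*} (G : SimpleGraph V) : ℕ∞ :=
  ⨅ k ∈ {k : ℕ | ∃ c : G.TotalColoring (Fin k), c.IsTLIR}, (k : ℕ∞)

/-- A cactus is a connected graph in which any two distinct cycles are edge-disjoint. Cycles are
identified with the subgraphs they trace, so that changing the starting point or the direction of
a closed walk does not change the cycle. -/
structure IsCactus {V : Type*} (G : SimpleGraph V) : Prop where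
  connected : G.Connected
  edge_disjoint : ∀ (u v : V) (p : G.Walk u u) (q : G.Walk v v), p.IsCycle → q.IsCycle →
    p.toSubgraph ≠ q.toSubgraph → Disjoint p.toSubgraph.edgeSet q.toSubgraph.edgeSet

end SimpleGraph

/-! Fix a label `s`. Coloring `v` suitably rounds its marked degree up to the parity of `s v`, and
the total degrees of `v` in the two classes add up to its degree plus 1. By parity, an edge whose
ends have degrees of equal parity is good in either color if `s` differs at its ends; an edge whose
ends have degrees of different parity is good in a color dictated by `s`. Only equal-parity edges on
which `s` is constant remain. In a cactus the edges inside distance levels form a matching, and `s`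
can be chosen so that every remaining edge `xy` lies in a level and, up to swapping ends, `x` has an
equal-parity edge `xw` towards the root (`IsCactus.exists_almost_proper`). The colors of `xy` and
`xw` are free, and suitable ones make `xy` good (`exists_isGoodAt`). This can only disturb the level
edge at `w`, so repairs proceed from the farthest level inwards. -/

namespace SimpleGraph

variable {V : Type*} {G : SimpleGraph V}

/-! ### Bipartiteness and bridges -/

/-- A graph is bipartite if it becomes so after removing finitely many of its bridges. -/
lemma colorable_two_of_deleteEdges_bridges (F : Finset (Sym2 V)) :
    ∀ H : SimpleGraph V, (∀ e ∈ F, e ∈ H.edgeSet → H.IsBridge e) →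
      (H.deleteEdges F).Colorable 2 → H.Colorable 2 := by
  classical
  induction F using Finset.induction_on with
  | empty => intro H _ h; simpa using h
  | insert e F _ ih =>
    intro H hb hc
    by_cases he : e ∈ H.edgeSet
    swap
    · refine ih H (fun e' h' => hb e' (Finset.mem_insert_of_mem h')) ?_
      convert hc using 1
      ext a b
      simp only [deleteEdges_adj, Finset.coe_insert, Set.mem_insert_iff, not_or, Finset.mem_coe]
      exact ⟨fun h => ⟨h.1, fun h' => he (h' ▸ h.1), h.2⟩, fun h => ⟨h.1, h.2.2⟩⟩
    have hbe := hb e (Finset.mem_insert_self _ _) he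
    have h1 : (H.deleteEdges {e}).Colorable 2 := by
      refine ih _ (fun e' h' h'' => ?_) ?_
      · refine (hb e' (Finset.mem_insert_of_mem h') ?_).anti (deleteEdges_le _)
        exact edgeSet_mono (deleteEdges_le _) h''
      · rwa [deleteEdges_deleteEdges, ← Set.insert_eq, ← Finset.coe_insert]
    obtain ⟨x, y⟩ := e
    rw [isBridge_iff] at hbe
    obtain ⟨C⟩ := h1
    -- The bridge separates `x` from `y`: swapping the colors on the side of `x` changes the
    -- relation of the ends of no other edge.
    refine ⟨Coloring.mk (fun v => if (H.deleteEdges {s(x, y)}).Reachable x v ∧ C x = C y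
      then C v + 1 else C v) ?_⟩
    have key : ∀ a b : Fin 2, a ≠ b → a + 1 ≠ b + 1 := by decide
    intro a b hab
    by_cases hxy : s(a, b) = s(x, y)
    · rw [Sym2.eq_iff] at hxy
      by_cases hC : C x = C y
      · obtain ⟨rfl, rfl⟩ | ⟨rfl, rfl⟩ := hxy
        · simp [hC, hbe]
        · simp [hC, hbe]
      · obtain ⟨rfl, rfl⟩ | ⟨rfl, rfl⟩ := hxy
        · simp [hC]
        · simpa [hC] using Ne.symm hC
    · have hadj : (H.deleteEdges {s(x, y)}).Adj a b := by simp [hab, hxy]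
      have hv := C.valid hadj
      have hr : (H.deleteEdges {s(x, y)}).Reachable x a ↔
          (H.deleteEdges {s(x, y)}).Reachable x b :=
        ⟨fun h => h.trans hadj.reachable, fun h => h.trans hadj.reachable.symm⟩
      simp only [hr]
      split_ifs
      · exact key _ _ hv
      · exact hv

/-! ### Distance levels and cycles in a cactus -/

/-- A geodesic from the root meets the level of its end only in its end. -/
lemma Connected.exists_walk_dist_lt_or_eq (hG : G.Connected) (r v : V) :
    ∃ p : G.Walk r v, ∀ u ∈ p.support, G.dist r u < G.dist r v ∨ u = v := by
  classical
  obtain ⟨p, hp⟩ := hG.exists_walk_length_eq_dist r v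
  refine ⟨p, fun u hu => ?_⟩
  have h1 := congrArg Walk.length (p.take_spec hu)
  rw [Walk.length_append] at h1
  have h2 := G.dist_le (p.takeUntil u hu)
  rcases Nat.eq_zero_or_pos (p.dropUntil u hu).length with h0 | h0
  · exact Or.inr (Walk.eq_of_length_eq_zero h0)
  · left; omega

/-- An edge `xy` between vertices at the same distance from the root lies, together with any edge
`xw` towards the root, on a cycle. -/
lemma Connected.exists_isCycle_of_dist_eq (hG : G.Connected) {r x y w : V} (hxy : G.Adj x y)
    (hxw : G.Adj x w) (hy : G.dist r x = G.dist r y) (hw : G.dist r w < G.dist r x) :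
    ∃ p : G.Walk w w, p.IsCycle ∧ ∀ z, s(x, z) ∈ p.edges ↔ z = y ∨ z = w := by
  classical
  obtain ⟨p, hp⟩ := hG.exists_walk_dist_lt_or_eq r y
  obtain ⟨q, hq⟩ := hG.exists_walk_dist_lt_or_eq r w
  -- Apart from its end, a geodesic to `y` or `w` stays strictly closer to the root than `x`.
  have hx : x ∉ (p.reverse.append q).bypass.support := fun h => by
    have := Walk.support_bypass_subset_support _ h
    rw [Walk.mem_support_append_iff, Walk.support_reverse, List.mem_reverse] at this
    rcases this with h | h
    · rcases hp x h with h | h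
      · omega
      · exact hxy.ne h
    · rcases hq x h with h | h
      · omega
      · exact hxw.ne h
  have hpath : (p.reverse.append q).bypass.IsPath := Walk.bypass_isPath _
  have hyw : y ≠ w := by rintro rfl; omega
  generalize (p.reverse.append q).bypass = t at hx hpath
  have ht : ∀ z, s(x, z) ∉ t.edges := fun z h => hx (Walk.fst_mem_support_of_mem_edges _ h)
  refine ⟨.cons hxw.symm (.cons hxy t), ?_, fun z => ?_⟩
  · rw [Walk.cons_isCycle_iff]
    refine ⟨hpath.cons hx, ?_⟩
    rw [Walk.edges_cons, List.mem_cons, not_or]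
    refine ⟨?_, by rw [Sym2.eq_swap]; exact ht w⟩
    rw [Sym2.eq_swap, Sym2.congr_right]
    exact hyw.symm
  · rw [Walk.edges_cons, Walk.edges_cons, List.mem_cons, List.mem_cons, Sym2.eq_swap (a := w),
      Sym2.congr_right, Sym2.congr_right]
    simp only [ht z, or_false]
    tauto

lemma Connected.exists_adj_dist_lt (hG : G.Connected) {r x y : V} (hxy : G.Adj x y)
    (hy : G.dist r x = G.dist r y) : ∃ w, G.Adj x w ∧ G.dist r w < G.dist r x := by
  have hx : r ≠ x := by
    rintro rfl
    rw [dist_self] at hy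
    exact hxy.ne (hG.dist_eq_zero_iff.mp hy.symm)
  obtain ⟨p, hp⟩ := hG.exists_walk_length_eq_dist x r
  cases p with
  | nil => exact absurd rfl hx
  | @cons _ w _ h q =>
    refine ⟨w, h, ?_⟩
    have := G.dist_le q
    rw [dist_comm (u := r), dist_comm (u := r), ← hp, Walk.length_cons]
    omega

/-- The contrapositive of edge-disjointness, the form in which the cactus hypothesis is used. -/
lemma IsCactus.mem_edges_iff (hG : G.IsCactus) {u v : V} {p : G.Walk u u} {q : G.Walk v v}
    (hp : p.IsCycle) (hq : q.IsCycle) {e : Sym2 V} (hep : e ∈ p.edges) (heq : e ∈ q.edges)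
    (f : Sym2 V) : f ∈ p.edges ↔ f ∈ q.edges := by
  by_cases h : p.toSubgraph = q.toSubgraph
  · rw [← Walk.mem_edges_toSubgraph, h, Walk.mem_edges_toSubgraph]
  · refine absurd (hG.edge_disjoint u v p q hp hq h) (Set.not_disjoint_iff.mpr ⟨e, ?_, ?_⟩)
    · rwa [Walk.mem_edges_toSubgraph]
    · rwa [Walk.mem_edges_toSubgraph]

/-- In a cactus the edges inside the distance levels form a matching. -/
lemma IsCactus.eq_of_adj_of_dist_eq (hG : G.IsCactus) {r x y z : V} (hxy : G.Adj x y)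
    (hxz : G.Adj x z) (hy : G.dist r x = G.dist r y) (hz : G.dist r x = G.dist r z) : y = z := by
  obtain ⟨w, hxw, hw⟩ := hG.connected.exists_adj_dist_lt hxy hy
  obtain ⟨p, hp, hpe⟩ := hG.connected.exists_isCycle_of_dist_eq hxy hxw hy hw
  obtain ⟨q, hq, hqe⟩ := hG.connected.exists_isCycle_of_dist_eq hxz hxw hz hw
  -- Both cycles contain `xw`, so they share their other edge at `x` too.
  have := hG.mem_edges_iff hp hq ((hpe w).mpr (.inr rfl)) ((hqe w).mpr (.inr rfl)) s(x, y)
  rw [hpe, hqe] at this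
  rcases this.mp (.inl rfl) with h | rfl
  · exact h
  · omega

/-- Given a vertex labelling `d` of a cactus, some 2-coloring `s` of the vertices leaves only few
edges unproperly colored among those with equally labelled ends: they form a matching inside the
levels of a height function, and each of them meets a lower vertex of the same label. -/
lemma IsCactus.exists_almost_proper [Finite V] (hG : G.IsCactus) {α : Type*} (d : V → α) :
    ∃ (s : V → Fin 2) (l : V → ℕ),
      (∀ x y, G.Adj x y → d x = d y → s x = s y → l x = l y ∧
        ((∃ w, G.Adj x w ∧ d x = d w ∧ l w < l x) ∨ ∃ w, G.Adj y w ∧ d y = d w ∧ l w < l y)) ∧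
      ∀ x y z, G.Adj x y → G.Adj x z → l x = l y → l x = l z → y = z := by
  classical
  cases nonempty_fintype V
  obtain ⟨r⟩ := hG.connected.nonempty
  set l : V → ℕ := G.dist r with hl
  let D : V → Prop := fun x => ∃ w, G.Adj x w ∧ d x = d w ∧ l w < l x
  let H : SimpleGraph V :=
    { Adj := fun x y => G.Adj x y ∧ d x = d y ∧ ¬ (l x = l y ∧ (D x ∨ D y))
      symm := ⟨fun x y h => ⟨h.1.symm, h.2.1.symm, fun h' => h.2.2 ⟨h'.1.symm, h'.2.symm⟩⟩⟩
      loopless := ⟨fun x h => h.1.ne rfl⟩ }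
  have hHG : H ≤ G := fun x y h => h.1
  let F : Finset (Sym2 V) := Finset.univ.filter fun e => ∃ x y, e = s(x, y) ∧ l x = l y
  have hH : H.Colorable 2 := by
    refine colorable_two_of_deleteEdges_bridges F H ?_ ?_
    -- A cycle of `H` through a level edge `xy` has the edges of the geodesic cycle through `xy` and
    -- `xw`. So `xw` lies in `H`, giving `D x`, and `xy` was excluded from `H`.
    · intro e heF heH
      obtain ⟨x, y, rfl, hxy⟩ := (Finset.mem_filter.mp heF).2
      rw [isBridge_iff_forall_cycle_notMem heH]
      intro u p hp hep
      have hadj : H.Adj x y := heH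
      obtain ⟨w, hxw, hw⟩ := hG.connected.exists_adj_dist_lt hadj.1 hxy
      obtain ⟨q, hq, hqe⟩ := hG.connected.exists_isCycle_of_dist_eq hadj.1 hxw hxy hw
      have h := (hG.mem_edges_iff (hp.mapLe hHG) hq (e := s(x, y))
        (by rwa [Walk.edges_mapLe_eq_edges]) ((hqe y).mpr (.inl rfl)) s(x, w)).mpr
        ((hqe w).mpr (.inr rfl))
      rw [Walk.edges_mapLe_eq_edges] at h
      have hxwH : H.Adj x w := p.adj_of_mem_edges h
      exact hadj.2.2 ⟨hxy, .inl ⟨w, hxw, hxwH.2.1, hw⟩⟩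
    · refine ⟨Coloring.mk (fun v => (⟨l v % 2, Nat.mod_lt _ two_pos⟩ : Fin 2)) ?_⟩
      intro a b hab h
      rw [deleteEdges_adj] at hab
      have hne : l a ≠ l b := fun h' => hab.2 (by simpa [F] using ⟨a, b, .inl ⟨rfl, rfl⟩, h'⟩)
      have h2 : l a % 2 = l b % 2 := congrArg Fin.val h
      have := hab.1.1.diff_dist_adj (u := r)
      simp only [← hl] at this
      omega
  obtain ⟨C⟩ := hH
  refine ⟨C, l, fun x y hxy hd hs => ?_, fun x y z hxy hxz hy hz =>
    hG.eq_of_adj_of_dist_eq hxy hxz hy hz⟩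
  by_contra hcon
  exact C.valid (v := x) (w := y) ⟨hxy, hd, hcon⟩ hs

/-! ### Parity of total degrees and local repairs -/

/-- The number of edges at `v` that are marked by `c`. -/
noncomputable def markedDegree (G : SimpleGraph V) (c : Sym2 V → Bool) (v : V) : ℕ :=
  {e ∈ G.edgeSet | v ∈ e ∧ c e = true}.ncard

/-- The marked degree, rounded up to a number of the parity of `s`. -/
noncomputable def roundedDegree (G : SimpleGraph V) (c : Sym2 V → Bool) (s : V → Fin 2) (v : V) :
    ℕ :=
  G.markedDegree c v + (G.markedDegree c v + s v) % 2

/-- Both color classes of edges of `c` are locally irregular at the edge `uv`, when the total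
degree of `v` in the marked class is the rounded degree. -/
def IsGoodAt (G : SimpleGraph V) (c : Sym2 V → Bool) (s : V → Fin 2) (u v : V) : Prop :=
  if c s(u, v) then G.roundedDegree c s u ≠ G.roundedDegree c s v
  else G.roundedDegree c s u + (G.incidenceSet v).ncard ≠
    G.roundedDegree c s v + (G.incidenceSet u).ncard

lemma IsGoodAt.symm {c : Sym2 V → Bool} {s : V → Fin 2} {u v : V} (h : G.IsGoodAt c s u v) :
    G.IsGoodAt c s v u := by
  unfold IsGoodAt at h ⊢
  rw [Sym2.eq_swap]
  split_ifs at h ⊢ <;> exact h.symm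

lemma markedDegree_congr {c c' : Sym2 V → Bool} {v : V}
    (h : ∀ u, c' s(v, u) = c s(v, u)) : G.markedDegree c' v = G.markedDegree c v := by
  unfold markedDegree
  congr 1
  ext e
  simp only [Set.mem_ofPred_eq, and_congr_right_iff]
  rintro - ⟨u, rfl⟩
  rw [h]

lemma IsGoodAt.congr {c c' : Sym2 V → Bool} {s : V → Fin 2} {u v : V} (h : G.IsGoodAt c s u v)
    (hu : ∀ z, c' s(u, z) = c s(u, z)) (hv : ∀ z, c' s(v, z) = c s(v, z)) :
    G.IsGoodAt c' s u v := by
  unfold IsGoodAt roundedDegree at h ⊢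
  rwa [hu v, markedDegree_congr hu, markedDegree_congr hv]

open Classical in
lemma markedDegree_update_true [Finite V] {c : Sym2 V → Bool} {u v : V} (h : G.Adj v u) :
    G.markedDegree (Function.update c s(v, u) true) v =
      G.markedDegree (Function.update c s(v, u) false) v + 1 := by
  unfold markedDegree
  rw [← Set.ncard_insert_of_notMem (a := s(v, u)) (by simp) (Set.toFinite _)]
  congr 1
  ext e
  by_cases he : e = s(v, u)
  · subst he; simp [h]
  · simp [he, Function.update_of_ne]

/-- The colors of two adjacent edges `xy` and `xw` can be chosen to make `xy` good. -/
lemma exists_isGoodAt [Finite V] (c : Sym2 V → Bool) (s : V → Fin 2) {x y w : V}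
    (hxy : G.Adj x y) (hxw : G.Adj x w) (hyw : y ≠ w) :
    ∃ c' : Sym2 V → Bool, (∀ e, e ≠ s(x, y) → e ≠ s(x, w) → c' e = c e) ∧ G.IsGoodAt c' s x y := by
  classical
  have hne : s(x, y) ≠ s(x, w) := by rwa [Ne, Sym2.congr_right]
  let f : Bool → Bool → Sym2 V → Bool := fun β γ =>
    Function.update (Function.update c s(x, y) β) s(x, w) γ
  have hf : ∀ β γ, f β γ = Function.update (Function.update c s(x, w) γ) s(x, y) β :=
    fun β γ => (Function.update_comm hne.symm _ _ _).symm
  have hfxy : ∀ β γ, f β γ s(x, y) = β := fun β γ => by rw [hf, Function.update_self]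
  have hγ : ∀ β, G.markedDegree (f β true) x = G.markedDegree (f β false) x + 1 :=
    fun β => markedDegree_update_true hxw
  have hβ : G.markedDegree (f true false) x = G.markedDegree (f false false) x + 1 := by
    rw [hf, hf]; exact markedDegree_update_true hxy
  have hy : ∀ β, G.markedDegree (f β true) y = G.markedDegree (f β false) y := fun β => by
    refine markedDegree_congr fun u => ?_
    have : s(y, u) ≠ s(x, w) := by
      rw [Ne, Sym2.eq_iff]
      rintro (⟨rfl, -⟩ | ⟨rfl, -⟩)
      · exact hxy.ne rfl
      · exact hyw rfl
    simp only [f, Function.update_of_ne this]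
  -- With `xw` unmarked, `β` gives the marked degree of `x` the parity of `s x`. Marking `xw` then
  -- raises the rounded degree of `x` by 2 and fixes that of `y`, so at most one choice for `xw` is
  -- bad.
  obtain ⟨β, h0⟩ : ∃ β, (G.markedDegree (f β false) x + s x) % 2 = 0 := by
    rcases Nat.mod_two_eq_zero_or_one (G.markedDegree (f false false) x + s x) with h | h
    · exact ⟨false, h⟩
    · exact ⟨true, by omega⟩
  have hx1 : G.roundedDegree (f β true) s x = G.roundedDegree (f β false) s x + 2 := by
    unfold roundedDegree
    rw [hγ]
    omega
  have hy1 : G.roundedDegree (f β true) s y = G.roundedDegree (f β false) s y := by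
    unfold roundedDegree
    rw [hy]
  have hoff : ∀ γ e, e ≠ s(x, y) → e ≠ s(x, w) → f β γ e = c e := fun γ e h1 h2 => by
    simp only [f, Function.update_of_ne h2, Function.update_of_ne h1]
  by_cases hgood : G.IsGoodAt (f β false) s x y
  · exact ⟨_, hoff false, hgood⟩
  · refine ⟨_, hoff true, ?_⟩
    unfold IsGoodAt at hgood ⊢
    rw [hfxy] at hgood ⊢
    split_ifs at hgood ⊢ <;> omega

/-- In a cactus the edges can be split into two classes, so that every edge is good. -/
lemma IsCactus.exists_forall_isGoodAt [Finite V] (hG : G.IsCactus) :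
    ∃ (c : Sym2 V → Bool) (s : V → Fin 2), ∀ x y, G.Adj x y → G.IsGoodAt c s x y := by
  classical
  cases nonempty_fintype V
  let d : V → ℕ := fun v => (G.incidenceSet v).ncard % 2
  obtain ⟨s, l, hs, hl⟩ := hG.exists_almost_proper d
  let D : V → Prop := fun x => ∃ w, G.Adj x w ∧ d x = d w ∧ l w < l x
  have key : ∀ S : Finset V, ∃ c : Sym2 V → Bool,
      (∀ x y, d x ≠ d y → (c s(x, y) = true ↔ s x ≠ s y)) ∧
      ∀ x ∈ S, D x → ∀ y, G.Adj x y → d x = d y → l x = l y → G.IsGoodAt c s x y := by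
    intro S
    -- Vertices enter by decreasing level: a repair at `a` affects only `a`, its partner `b`, and a
    -- vertex `w` strictly below all of `S`.
    induction S using Finset.induction_on_min_value l with
    | empty =>
      -- The color dictated by parity when `d x ≠ d y`; on other edges any start would do.
      refine ⟨fun e => Sym2.lift ⟨fun x y => decide (s x ≠ s y), fun x y => ?_⟩ e, ?_, by simp⟩
      · simp [eq_comm]
      · simp
    | insert a S _ hmin ih =>
      obtain ⟨c, hc, hS⟩ := ih
      by_cases ha : D a ∧ ∃ b, G.Adj a b ∧ d a = d b ∧ l a = l b
      swap
      · refine ⟨c, hc, fun x hx hD y hxy hd hlxy => ?_⟩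
        rcases Finset.mem_insert.mp hx with rfl | hx
        · exact absurd ⟨hD, y, hxy, hd, hlxy⟩ ha
        · exact hS x hx hD y hxy hd hlxy
      obtain ⟨⟨w, haw, hdw, hlw⟩, b, hab, hdb, hlb⟩ := ha
      obtain ⟨c', hc', hgood⟩ := exists_isGoodAt (w := w) c s hab haw (by rintro rfl; omega)
      refine ⟨c', fun x y hd => ?_, fun x hx hD y hxy hd hlxy => ?_⟩
      · rw [hc', hc x y hd]
        · rw [Ne, Sym2.eq_iff]
          rintro (⟨rfl, rfl⟩ | ⟨rfl, rfl⟩)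
          · exact hd hdb
          · exact hd hdb.symm
        · rw [Ne, Sym2.eq_iff]
          rintro (⟨rfl, rfl⟩ | ⟨rfl, rfl⟩)
          · exact hd hdw
          · exact hd hdw.symm
      · rcases eq_or_ne x a with rfl | hxa
        · rwa [hl x y b hxy hab hlxy hlb]
        have hxS := Finset.mem_of_mem_insert_of_ne hx hxa
        rcases eq_or_ne x b with rfl | hxb
        · rw [hl x y a hxy hab.symm hlxy hlb.symm]
          exact hgood.symm
        have hya : y ≠ a := by
          rintro rfl
          exact hxb (hl y x b hxy.symm hab hlxy.symm hlb)
        have hyb : y ≠ b := by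
          rintro rfl
          exact hxa (hl y x a hxy.symm hab.symm hlxy.symm hlb.symm)
        have hle := hmin x hxS
        have hxw : x ≠ w := by rintro rfl; omega
        have hyw : y ≠ w := by rintro rfl; omega
        have off : ∀ v, v ≠ a → v ≠ b → v ≠ w → ∀ z, c' s(v, z) = c s(v, z) := by
          intro v h1 h2 h3 z
          apply hc' <;> rw [Ne, Sym2.eq_iff] <;> tauto
        exact (hS x hxS hD y hxy hd hlxy).congr (off x hxa hxb hxw) (off y hya hyb hyw)
  obtain ⟨c, hc, hS⟩ := key Finset.univ
  refine ⟨c, s, fun x y hxy => ?_⟩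
  by_cases hd : d x = d y
  · by_cases hsxy : s x = s y
    · obtain ⟨hlxy, hD | hD⟩ := hs x y hxy hd hsxy
      · exact hS x (Finset.mem_univ _) hD y hxy hd hlxy
      · exact (hS y (Finset.mem_univ _) hD x hxy.symm hd.symm hlxy.symm).symm
    · have hsxy' : (s x : ℕ) ≠ s y := fun h => hsxy (Fin.ext h)
      have hd' : (G.incidenceSet x).ncard % 2 = (G.incidenceSet y).ncard % 2 := hd
      unfold IsGoodAt roundedDegree
      split_ifs <;> omega
  · have hcxy := hc x y hd
    have hd' : (G.incidenceSet x).ncard % 2 ≠ (G.incidenceSet y).ncard % 2 := hd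
    unfold IsGoodAt roundedDegree
    split_ifs with h
    · have hsxy' : (s x : ℕ) ≠ s y := fun h' => hcxy.mp h (Fin.ext h')
      omega
    · have hsxy' : (s x : ℕ) = s y := by
        by_contra h'
        exact h (hcxy.mpr fun h'' => h' (congrArg Fin.val h''))
      omega

/-- An edge splitting all of whose edges are good extends to a locally irregular total coloring. -/
lemma exists_isTLIR_of_forall_isGoodAt [Finite V] {c : Sym2 V → Bool} {s : V → Fin 2}
    (h : ∀ x y, G.Adj x y → G.IsGoodAt c s x y) : ∃ C : G.TotalColoring (Fin 2), C.IsTLIR := by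
  classical
  let C : G.TotalColoring (Fin 2) :=
    { vertexColor := fun v => if (G.markedDegree c v + s v) % 2 = 1 then 1 else 0
      edgeColor := fun e => if c e.1 then 1 else 0 }
  have hedge1 : ∀ e, e ∈ (C.colorClass 1).edges ↔ e ∈ G.edgeSet ∧ c e = true := fun e => by
    simp [TotalColoring.colorClass, C]
  have hedge0 : ∀ e, e ∈ (C.colorClass 0).edges ↔ e ∈ G.edgeSet ∧ c e = false := fun e => by
    simp [TotalColoring.colorClass, C]
  have hset1 : ∀ v, {e ∈ (C.colorClass 1).edges | v ∈ e} =
      {e ∈ G.edgeSet | v ∈ e ∧ c e = true} := fun v => by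
    ext e
    simp only [Set.mem_ofPred_eq, hedge1]
    tauto
  have hset0 : ∀ v, {e ∈ (C.colorClass 0).edges | v ∈ e} =
      G.incidenceSet v \ {e ∈ G.edgeSet | v ∈ e ∧ c e = true} := fun v => by
    ext e
    simp only [Set.mem_ofPred_eq, hedge0, incidenceSet, Set.mem_sdiff, ← Bool.not_eq_true]
    tauto
  have hsub : ∀ v, {e ∈ G.edgeSet | v ∈ e ∧ c e = true} ⊆ G.incidenceSet v :=
    fun v e he => ⟨he.1, he.2.1⟩
  have hd1 : ∀ v, (C.colorClass 1).totalDegree v = G.roundedDegree c s v := fun v => by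
    have hfull : v ∈ (C.colorClass 1).fullVerts ↔ (G.markedDegree c v + s v) % 2 = 1 := by
      simp [TotalColoring.colorClass, C]
    unfold TotalGraph.totalDegree roundedDegree
    rw [hset1, ← markedDegree]
    simp only [hfull]
    split_ifs <;> omega
  -- Each vertex is full in exactly one class. This identity turns the unmarked case of `IsGoodAt`,
  -- written without subtraction, into distinct total degrees.
  have hd0 : ∀ v, (C.colorClass 0).totalDegree v + G.roundedDegree c s v =
      (G.incidenceSet v).ncard + 1 := fun v => by
    have hfull : v ∈ (C.colorClass 0).fullVerts ↔ ¬ (G.markedDegree c v + s v) % 2 = 1 := by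
      simp [TotalColoring.colorClass, C]
    have hcard := Set.ncard_sdiff_add_ncard_of_subset (hsub v) (Set.toFinite _)
    unfold TotalGraph.totalDegree roundedDegree
    rw [hset0]
    rw [← markedDegree] at hcard
    simp only [hfull]
    split_ifs <;> omega
  refine ⟨C, Fin.forall_fin_two.mpr ⟨fun u v he => ?_, fun u v he => ?_⟩⟩
  · rw [hedge0] at he
    have hg := h u v he.1
    simp only [IsGoodAt, he.2, Bool.false_eq_true, if_false] at hg
    have hu := hd0 u
    have hv := hd0 v
    omega
  · rw [hedge1] at he
    have hg := h u v he.1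
    simp only [IsGoodAt, he.2, if_true] at hg
    rwa [hd1, hd1]

end SimpleGraph

theorem mainTheorem1 {V : Type*} [Finite V] (G : SimpleGraph V) (hG : G.IsCactus) :
    G.tlir ≤ 2 ∧ ∃ c : G.TotalColoring (Fin 2), c.IsTLIR := by
  obtain ⟨c, s, h⟩ := hG.exists_forall_isGoodAt
  have hC := SimpleGraph.exists_isTLIR_of_forall_isGoodAt h
  exact ⟨iInf₂_le (α := ℕ∞) 2 hC, hC⟩
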